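/- Let $f:\{0,1\}^n\to\{0,1\}$. We say that $f$ depends on all its inputs if for every $i\in[n]$ there is an $x\in\{0,1\}^n$ at which flipping the $i$-th bit changes the value of $f$. The alternation $\mathsf{alt}(f)$ is the maximum, over all chains $0^n=x_0<x_1<\dots<x_n=1^n$ in the Boolean hypercube (coordinatewise order), of the number of $i\in[n]$ with $f(x_{i-1})\neq f(x_i)$. The sparsity $\mathsf{sparsity}(f)$ is the number of sets $S\subseteq[n]$ for which the Fourier coefficient $\frac{1}{2^n}\sum_{x\in\{0,1\}^n}(1-2f(x))(-1)^{\sum_{i\in S}x_i}$ of $1-2f$ is non-zero. Finally, $\mathsf{CC}_\oplus(f)$ is the deterministic two-party communication complexity of $f^\oplus(x,y)=f(x\oplus y)$, i.e. the least worst-case number of bits exchanged by a deterministic protocol in which Alice holds $x\in\{0,1\}^n$, Bob holds $y\in\{0,1\}^n$, and which computes $f(x\oplus y)$. **Theorem.** For functions that depend on all their inputs and have at most polylogarithmic alternation, the XOR Log-Rank Conjecture holds for all large enough $n$. That is: for every real $A$ and every integer $a\ge 0$ there are a real $C$ and integers $k,N\ge 0$, depending only on $A$ and $a$, such that for every $n\ge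 N$ and every $f:\{0,1\}^n\to\{0,1\}$ that depends on all its inputs and satisfies $\mathsf{alt}(f)\le A\,(\log_2 n)^a$, $$\mathsf{CC}_\oplus(f)\le C\,\bigl(\log_2 \mathsf{sparsity}(f)\bigr)^k .$$ -/

import Mathlib

namespace XorLogRank

/-- The Boolean cube `{0,1}^n`. -/
abbrev Cube (n : ℕ) : Type := Fin n → Bool

/-- `f` depends on all its inputs: every coordinate is relevant, that is, for each `i` flipping
the bit `i` changes the value of `f` at some point. -/
def DependsOnAllInputs {n : ℕ} (f : Cube n → Bool) : Prop :=
  ∀ i : Fin n, ∃ x : Cube n, f (Function.update x i (!x i)) ≠ f x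

/-! ### Alternation -/

/-- A chain of the Boolean hypercube: points `x_0 < x_1 < ⋯ < x_n` of `{0,1}^n` in the
coordinatewise order. Being strictly increasing with `n + 1` points it is a maximal chain, so
`x_0 = 0^n`, `x_n = 1^n`, and exactly `i` coordinates of `x_i` are one. -/
def IsChainOfCube {n : ℕ} (x : Fin (n + 1) → Cube n) : Prop :=
  StrictMono x

/-- The number of indices `i ∈ {1, …, n}` with `f x_{i-1} ≠ f x_i`. -/
def altOn {n : ℕ} (f : Cube n → Bool) (x : Fin (n + 1) → Cube n) : ℕ :=
  (Finset.univ.filter fun i : Fin n => f (x i.castSucc) ≠ f (x i.succ)).card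

open Classical in
/-- The alternation of `f`: the maximum of `altOn f x` over all chains `x`. -/
noncomputable def alt {n : ℕ} (f : Cube n → Bool) : ℕ :=
  (Finset.univ.filter fun x : Fin (n + 1) → Cube n => IsChainOfCube x).sup (altOn f)

/-! ### Fourier sparsity -/

/-- The character `χ_S(x) = (-1)^{∑_{i ∈ S} x_i}`. -/
def chi {n : ℕ} (S : Finset (Fin n)) (x : Cube n) : ℝ :=
  (-1) ^ (∑ i ∈ S, (x i).toNat)

/-- The Fourier coefficient at `S` of the `{-1,1}`-valued function `1 - 2 f`. -/
noncomputable def cubeFourierCoeff {n : ℕ} (f : Cube n → Bool) (S : Finset (Fin n)) : ℝ :=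
  (1 / 2 ^ n) * ∑ x : Cube n, (1 - 2 * ((f x).toNat : ℝ)) * chi S x

open Classical in
/-- The number of non-zero Fourier coefficients of `1 - 2 f`. -/
noncomputable def sparsity {n : ℕ} (f : Cube n → Bool) : ℕ :=
  (Finset.univ.filter fun S : Finset (Fin n) => cubeFourierCoeff f S ≠ 0).card

/-! ### Deterministic two-party communication -/

/-- A deterministic two-party protocol tree: at an inner node one of the players sends one bit,
which depends on that player's own input only (and on the node, i.e. on the bits exchanged so
far); a leaf carries the output. -/
inductive Protocol (X Y : Type) : Type
  | leaf (b : Bool) : Protocol X Y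
  | alice (m : X → Bool) (p₀ p₁ : Protocol X Y) : Protocol X Y
  | bob (m : Y → Bool) (p₀ p₁ : Protocol X Y) : Protocol X Y

namespace Protocol

variable {X Y : Type}

/-- The output of the protocol on the input pair `(x, y)`. -/
def eval : Protocol X Y → X → Y → Bool
  | leaf b, _, _ => b
  | alice m p₀ p₁, x, y => if m x then p₁.eval x y else p₀.eval x y
  | bob m p₀ p₁, x, y => if m y then p₁.eval x y else p₀.eval x y

/-- The number of bits exchanged on the input pair `(x, y)`. -/
def bits : Protocol X Y → X → Y → ℕ
  | leaf _, _, _ => 0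
  | alice m p₀ p₁, x, y => (if m x then p₁.bits x y else p₀.bits x y) + 1
  | bob m p₀ p₁, x, y => (if m y then p₁.bits x y else p₀.bits x y) + 1

/-- The protocol computes `F`. -/
def Computes (P : Protocol X Y) (F : X → Y → Bool) : Prop :=
  ∀ x y, P.eval x y = F x y

/-- The cost of the protocol: the number of bits exchanged in the worst case over all inputs. -/
def cost [Fintype X] [Fintype Y] (P : Protocol X Y) : ℕ :=
  Finset.univ.sup fun z : X × Y => P.bits z.1 z.2

/-- Every function on finite sets is computed by some protocol, so the minimum in the definition
of the communication complexity is over a non-empty set. -/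
theorem exists_computes [Fintype X] (F : X → Y → Bool) : ∃ P : Protocol X Y, P.Computes F := by
  classical
  have key : ∀ s : Finset X, ∃ P : Protocol X Y, ∀ x ∈ s, ∀ y, P.eval x y = F x y := by
    intro s
    induction s using Finset.induction_on with
    | empty => exact ⟨leaf false, by simp⟩
    | insert a s _ ih =>
      obtain ⟨P, hP⟩ := ih
      refine ⟨alice (fun x => decide (x = a)) P (bob (F a) (leaf false) (leaf true)), ?_⟩
      intro x hx y
      by_cases hxa : x = a
      · subst hxa
        cases h : F x y <;> simp [eval, h]
      · have hxs : x ∈ s := by simpa [hxa] using hx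
        simp [eval, hxa, hP x hxs y]
  obtain ⟨P, hP⟩ := key Finset.univ
  exact ⟨P, fun x y => hP x (Finset.mem_univ x) y⟩

end Protocol

/-- The deterministic communication complexity of `F`: the least cost of a protocol
computing `F`. -/
noncomputable def CC {X Y : Type} [Fintype X] [Fintype Y] (F : X → Y → Bool) : ℕ :=
  sInf {c : ℕ | ∃ P : Protocol X Y, P.Computes F ∧ P.cost = c}

/-- The function `(x, y) ↦ f (x ⊕ y)`, with `⊕` the bitwise parity. -/
def xorFun {n : ℕ} (f : Cube n → Bool) : Cube n → Cube n → Bool :=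
  fun x y => f (fun i => xor (x i) (y i))

/-- The deterministic communication complexity of `(x, y) ↦ f (x ⊕ y)`. -/
noncomputable def CCxor {n : ℕ} (f : Cube n → Bool) : ℕ :=
  CC (xorFun f)

end XorLogRank

/-!
Write `s` for the sparsity of `f`, `k` for its alternation and `d` for its degree as a polynomial
over the two-element field.

The degree is at most `max 1 (log₂ s)` (`degreeLE_max_log_sparsity`): a subcube on which `f` has odd
parity, with a set `S` of at least two free coordinates, carries only non-zero Fourier coefficients,
and each of them forces a set of the Fourier support of `f` with a prescribed trace on `S`.

A function of degree `d` and alternation `k` has a decision tree of depth `k d²`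
(`DegreeLE.decisionTree`). Indeed, climb from `0` to a minimal point at which the value differs: on
the subcube in between `f` is a monomial up to a constant, so at most `d` bits have been set. After
at most `k` climbs `f` is constant above the point reached, so fixing some `k d` bits makes `f`
constant (`exists_const_above`). Querying these bits lowers the degree, whatever the answers are
(`DegreeLE.restrict`), and does not raise the alternation.

A decision tree is simulated by a protocol that exchanges two bits per query, so the communication
complexity is at most `2 k d²`. It remains to bound `k`, which is polylogarithmic in `n`, in terms of
`s`. The sets in the Fourier support have at most `k d²` elements and cover all relevant coordinates,
so `n ≤ s k d² ≤ 2 k s²` (`DecisionTree.le_sparsity_mul`). For large `n` this gives `n ≤ s⁴`, so that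
`log₂ n ≤ 4 log₂ s`.
-/

namespace XorLogRank

variable {n : ℕ}

/-! ### Fourier expansion -/

/-- The sign `(-1)^b` of a bit. -/
def sgn (b : Bool) : ℝ := if b then -1 else 1

lemma sgn_not (b : Bool) : sgn (!b) = -sgn b := by cases b <;> simp [sgn]

lemma one_sub_two_toNat (b : Bool) : 1 - 2 * (b.toNat : ℝ) = sgn b := by
  cases b <;> norm_num [sgn]

lemma chi_eq_prod (S : Finset (Fin n)) (x : Cube n) : chi S x = ∏ i ∈ S, sgn (x i) := by
  rw [chi, ← Finset.prod_pow_eq_pow_sum]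
  refine Finset.prod_congr rfl fun i _ => ?_
  cases x i <;> simp [sgn]

/-- The point obtained from `x` by flipping the bits in `U`. -/
def flip (U : Finset (Fin n)) (x : Cube n) : Cube n := fun i => if i ∈ U then !x i else x i

lemma flip_empty (x : Cube n) : flip ∅ x = x := by
  funext i; simp [flip]

lemma flip_singleton (i : Fin n) (x : Cube n) :
    flip {i} x = Function.update x i (!x i) := by
  funext j
  by_cases h : j = i
  · subst h; simp [flip]
  · simp [flip, h]

lemma flip_insert {U : Finset (Fin n)} {i : Fin n} (hi : i ∉ U) (x : Cube n) :
    flip (insert i U) x = flip U (flip {i} x) := by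
  funext j
  by_cases h : j = i
  · subst h; simp [flip, hi]
  · simp [flip, h]

lemma chi_flip (V U : Finset (Fin n)) (z : Cube n) :
    chi V (flip U z) = chi V z * ∏ i ∈ U, (if i ∈ V then -1 else 1 : ℝ) := by
  have h : ∏ i ∈ U, (if i ∈ V then -1 else 1 : ℝ) = ∏ i ∈ V, (if i ∈ U then -1 else 1 : ℝ) := by
    rw [Finset.prod_ite_mem, Finset.prod_ite_mem, Finset.inter_comm]
  rw [h, chi_eq_prod, chi_eq_prod, ← Finset.prod_mul_distrib]
  refine Finset.prod_congr rfl fun i _ => ?_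
  by_cases hi : i ∈ U <;> simp [flip, hi, sgn_not]

lemma sum_chi_mul_chi (x z : Cube n) :
    ∑ V : Finset (Fin n), chi V x * chi V z = if x = z then (2 : ℝ) ^ n else 0 := by
  have h : ∑ V : Finset (Fin n), chi V x * chi V z = ∏ i, (1 + sgn (x i) * sgn (z i)) := by
    rw [Finset.prod_one_add, Finset.powerset_univ]
    exact Finset.sum_congr rfl fun V _ => by
      rw [chi_eq_prod, chi_eq_prod, Finset.prod_mul_distrib]
  rw [h]
  split_ifs with hxz
  · subst hxz
    have : ∀ i, 1 + sgn (x i) * sgn (x i) = 2 := fun i => by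
      cases x i <;> norm_num [sgn]
    simp [this]
  · obtain ⟨i, hi⟩ := Function.ne_iff.1 hxz
    refine Finset.prod_eq_zero (Finset.mem_univ i) ?_
    revert hi
    cases x i <;> cases z i <;> simp [sgn]

lemma sum_fourier (f : Cube n → Bool) (z : Cube n) :
    ∑ V, cubeFourierCoeff f V * chi V z = sgn (f z) := by
  have h : ∀ V, cubeFourierCoeff f V * chi V z
      = (1 / 2 ^ n) * ∑ x, sgn (f x) * (chi V x * chi V z) := fun V => by
    rw [cubeFourierCoeff, mul_assoc, Finset.sum_mul]
    congr 1
    exact Finset.sum_congr rfl fun x _ => by rw [one_sub_two_toNat, mul_assoc]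
  simp_rw [h]
  rw [← Finset.mul_sum, Finset.sum_comm]
  simp_rw [← Finset.mul_sum, sum_chi_mul_chi]
  simp only [mul_ite, mul_zero, Finset.sum_ite_eq', Finset.mem_univ, if_true]
  field_simp

/-- A relevant coordinate lies in some set of the Fourier support. -/
lemma exists_mem_of_flip_ne {f : Cube n → Bool} {i : Fin n} {x : Cube n}
    (h : f (flip {i} x) ≠ f x) : ∃ S, i ∈ S ∧ cubeFourierCoeff f S ≠ 0 := by
  by_contra! hS
  have : sgn (f (flip {i} x)) = sgn (f x) := by
    rw [← sum_fourier, ← sum_fourier]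
    refine Finset.sum_congr rfl fun V _ => ?_
    by_cases hi : i ∈ V
    · rw [hS V hi]; simp
    · rw [chi_flip]; simp [hi]
  revert this h
  cases f (flip {i} x) <;> cases f x <;> norm_num [sgn]

/-! ### Degree over the two-element field -/

/-- The derivative of `f` over the two-element field, in the directions `S`, at `z`: the parity
of `f` on the subcube through `z` whose free coordinates are those in `S`. -/
def deriv (S : Finset (Fin n)) (f : Cube n → Bool) (z : Cube n) : ZMod 2 :=
  ∑ U ∈ S.powerset, ((f (flip U z)).toNat : ZMod 2)

/-- `f` has degree at most `d` as a polynomial over the two-element field, expressed by the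
vanishing of all derivatives of order greater than `d`. -/
def DegreeLE (d : ℕ) (f : Cube n → Bool) : Prop :=
  ∀ (S : Finset (Fin n)) (z : Cube n), d < S.card → deriv S f z = 0

lemma deriv_insert {S : Finset (Fin n)} {i : Fin n} (hi : i ∉ S) (f : Cube n → Bool)
    (z : Cube n) : deriv (insert i S) f z = deriv S f z + deriv S f (flip {i} z) := by
  rw [deriv, Finset.sum_powerset_insert hi]
  congr 1
  refine Finset.sum_congr rfl fun U hU => ?_
  rw [flip_insert fun h => hi (Finset.mem_powerset.1 hU h)]

lemma zmod_two_add_self (c : ZMod 2) : c + c = 0 := CharTwo.add_self_eq_zero c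

lemma two_pow_zmod_two {m : ℕ} (hm : m ≠ 0) : ((2 ^ m : ℕ) : ZMod 2) = 0 := by
  rw [ZMod.natCast_eq_zero_iff]
  exact dvd_pow_self 2 hm

lemma deriv_eq_zero_of_const {S : Finset (Fin n)} (hS : S.Nonempty) {f : Cube n → Bool}
    {z : Cube n} {b : Bool} (h : ∀ U ⊆ S, f (flip U z) = b) : deriv S f z = 0 := by
  rw [deriv, Finset.sum_congr rfl fun U hU => by rw [h U (Finset.mem_powerset.1 hU)],
    Finset.sum_const, Finset.card_powerset, nsmul_eq_mul, two_pow_zmod_two hS.card_ne_zero,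
    zero_mul]

/-- A function that takes one value on a subcube except at the corner opposite to `z` has odd
parity there: up to a constant, it is a monomial on that subcube. -/
lemma deriv_eq_one {S : Finset (Fin n)} (hS : S.Nonempty) {f : Cube n → Bool} {z : Cube n}
    (h : ∀ U ⊂ S, f (flip U z) = f z) (hne : f (flip S z) ≠ f z) : deriv S f z = 1 := by
  have h0 : ∑ _U ∈ S.powerset, ((f z).toNat : ZMod 2) = 0 := by
    rw [Finset.sum_const, Finset.card_powerset, nsmul_eq_mul, two_pow_zmod_two hS.card_ne_zero,
      zero_mul]
  rw [← add_zero (deriv S f z), ← h0, deriv, ← Finset.sum_add_distrib,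
    Finset.sum_eq_single_of_mem S (Finset.mem_powerset_self S)]
  · revert hne
    cases f (flip S z) <;> cases f z <;> simp
  · intro U hU hne'
    rw [h U ((Finset.mem_powerset.1 hU).ssubset_of_ne hne'), zmod_two_add_self]

/-- If the restriction of `f` to the subcube through `z` with free coordinates `S` has odd parity,
and `S` has at least two elements, then all Fourier coefficients of the restriction are non-zero:
up to normalisation they are integers congruent to `2` modulo `4`. The bound on `S` is needed, since
a single bit has the Fourier coefficient `0` at the empty set. -/
lemma sum_sgn_ne_zero {S W : Finset (Fin n)} {f : Cube n → Bool} {z : Cube n}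
    (hS : 2 ≤ S.card) (h : deriv S f z ≠ 0) :
    ∑ U ∈ S.powerset, sgn (f (flip U z)) * ∏ i ∈ U, (if i ∈ W then -1 else 1 : ℝ) ≠ 0 := by
  let ε : Finset (Fin n) → ℤ := fun U => ∏ i ∈ U, (if i ∈ W then -1 else 1 : ℤ)
  have hε : ∀ U, ε U = 1 ∨ ε U = -1 := fun U => by
    refine Finset.prod_induction _ (fun e : ℤ => e = 1 ∨ e = -1) ?_ (Or.inl rfl) fun i _ => ?_
    · rintro _ _ (rfl | rfl) (rfl | rfl) <;> simp
    · split_ifs <;> simp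
  -- The sum of a character is a product of `|S|` factors, each `0` or `2`.
  have hsum : (4 : ℤ) ∣ ∑ U ∈ S.powerset, ε U := by
    rw [← Finset.prod_one_add]
    have h2 : ∀ i ∈ S, (2 : ℤ) ∣ 1 + (if i ∈ W then -1 else 1) := fun i _ => by
      split_ifs <;> norm_num
    have := Finset.prod_dvd_prod_of_dvd _ _ h2
    rw [Finset.prod_const] at this
    exact dvd_trans (by simpa using pow_dvd_pow (2 : ℤ) hS) this
  intro h0
  let N : ℤ := ∑ U ∈ S.powerset, ((f (flip U z)).toNat : ℤ)
  have hZ : ∑ U ∈ S.powerset, (1 - 2 * ((f (flip U z)).toNat : ℤ)) * ε U = 0 := by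
    have : ((∑ U ∈ S.powerset, (1 - 2 * ((f (flip U z)).toNat : ℤ)) * ε U : ℤ) : ℝ) = 0 := by
      rw [← h0]
      push_cast [ε]
      exact Finset.sum_congr rfl fun U _ => by rw [one_sub_two_toNat]
    exact_mod_cast this
  -- Modulo `4` the sign of the character in the term `2 f` does not matter.
  have hmod : (4 : ℤ) ∣ ∑ U ∈ S.powerset, ((1 - 2 * ((f (flip U z)).toNat : ℤ)) * ε U
      - ε U + 2 * ((f (flip U z)).toNat : ℤ)) := by
    refine Finset.dvd_sum fun U _ => ?_
    rcases hε U with h | h <;> rw [h] <;> cases f (flip U z) <;> norm_num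
  rw [Finset.sum_add_distrib, Finset.sum_sub_distrib, hZ, ← Finset.mul_sum] at hmod
  apply h
  have hN : (2 : ℤ) ∣ N := by
    change (4 : ℤ) ∣ _ - _ + 2 * N at hmod
    omega
  have := (ZMod.intCast_zmod_eq_zero_iff_dvd N 2).2 (by exact_mod_cast hN)
  simpa [N, deriv] using this

/-- Degree is at most the logarithm of the sparsity, apart from degree one: a subcube of odd parity
with free coordinates `S` makes every subset of `S` the trace of a set of the Fourier support. -/
lemma two_pow_card_le_sparsity {S : Finset (Fin n)} {f : Cube n → Bool} {z : Cube n}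
    (hS : 2 ≤ S.card) (h : deriv S f z ≠ 0) : 2 ^ S.card ≤ sparsity f := by
  classical
  rw [← Finset.card_powerset, sparsity]
  refine Finset.card_le_card_of_surjOn (fun V => V ∩ S) fun W hW => ?_
  have hWS : W ⊆ S := by simpa using hW
  have hne := sum_sgn_ne_zero (W := W) hS h
  -- The restricted coefficient at `W` collects the coefficients of `f` at those `V` whose trace
  -- on `S` is `W`: for all other `V` the product over `S` has a factor `1 - 1`.
  have key : ∑ U ∈ S.powerset, sgn (f (flip U z)) * ∏ i ∈ U, (if i ∈ W then -1 else 1 : ℝ)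
      = ∑ V, cubeFourierCoeff f V * chi V z *
        ∏ i ∈ S, (1 + (if i ∈ V then -1 else 1 : ℝ) * (if i ∈ W then -1 else 1)) := by
    simp_rw [Finset.prod_one_add, Finset.mul_sum]
    rw [Finset.sum_comm]
    refine Finset.sum_congr rfl fun U _ => ?_
    rw [← sum_fourier, Finset.sum_mul]
    exact Finset.sum_congr rfl fun V _ => by rw [chi_flip, Finset.prod_mul_distrib]; ring
  rw [key] at hne
  obtain ⟨V, _, hV⟩ := Finset.exists_ne_zero_of_sum_ne_zero hne
  refine ⟨V, by simpa using left_ne_zero_of_mul (left_ne_zero_of_mul hV), ?_⟩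
  have hV' := Finset.prod_ne_zero_iff.1 (right_ne_zero_of_mul hV)
  ext i
  by_cases hi : i ∈ S
  · have := hV' i hi
    by_cases h1 : i ∈ V <;> by_cases h2 : i ∈ W <;> simp_all
  · simpa [hi] using fun h => hi (hWS h)

lemma degreeLE_max_log_sparsity (f : Cube n → Bool) :
    DegreeLE (max 1 (Nat.log 2 (sparsity f))) f := by
  intro S z hS
  by_contra h
  have h1 := (max_lt_iff.1 hS).1
  have h2 := two_pow_card_le_sparsity h1 h
  exact absurd (Nat.le_log_of_pow_le one_lt_two h2) (not_le.2 (max_lt_iff.1 hS).2)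

lemma flip_singleton_eq_of_degreeLE_zero {f : Cube n → Bool} (h : DegreeLE 0 f) (i : Fin n)
    (x : Cube n) : f (flip {i} x) = f x := by
  by_contra hne
  have h1 : deriv {i} f x = 1 := deriv_eq_one (Finset.singleton_nonempty i)
    (fun U hU => by rw [Finset.ssubset_singleton_iff.1 hU, flip_empty]) hne
  rw [h {i} x (by simp)] at h1
  exact zero_ne_one h1

/-- A property of points that is invariant under flipping a single bit of `T` is invariant under
overwriting `T`. -/
lemma piecewise_eq_of_flip_eq {β : Type*} {F : Cube n → β} {T : Finset (Fin n)}
    (h : ∀ i ∈ T, ∀ x, F (flip {i} x) = F x) (b x : Cube n) : F (T.piecewise b x) = F x := by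
  classical
  induction T using Finset.induction_on with
  | empty => simp
  | insert i T hi ih =>
    have ih' := ih fun j hj => h j (Finset.mem_insert_of_mem hj)
    rw [Finset.piecewise_insert, ← ih']
    by_cases hb : b i = T.piecewise b x i
    · rw [hb, Function.update_eq_self]
    · rw [Bool.eq_not_of_ne hb, ← flip_singleton, h i (Finset.mem_insert_self i T)]

lemma eq_of_degreeLE_zero {f : Cube n → Bool} (h : DegreeLE 0 f) (x y : Cube n) : f x = f y := by
  have := piecewise_eq_of_flip_eq (F := f) (T := Finset.univ)
    (fun i _ x => flip_singleton_eq_of_degreeLE_zero h i x) x y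
  simpa using this

lemma flip_piecewise {T U : Finset (Fin n)} (h : Disjoint U T) (b z : Cube n) :
    flip U (T.piecewise b z) = T.piecewise b (flip U z) := by
  funext j
  by_cases hj : j ∈ T
  · simp [flip, hj, Finset.disjoint_right.1 h hj]
  · simp [flip, hj]

/-- If `f` is constant on one subcube obtained by fixing the bits in `T`, then fixing these bits in
any other way lowers the degree: derivatives of the top order do not depend on the point, so those
in directions outside `T` can be computed on the subcube where `f` is constant. -/
lemma DegreeLE.restrict {d : ℕ} {f : Cube n → Bool} (hf : DegreeLE (d + 1) f)
    {T : Finset (Fin n)} {c : Cube n} {v : Bool} (hc : ∀ x, f (T.piecewise c x) = v)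
    (b : Cube n) : DegreeLE d fun x => f (T.piecewise b x) := by
  intro S z hS
  by_cases hST : Disjoint S T
  · have hS0 : S.Nonempty := Finset.card_pos.1 (by omega)
    have hinv : ∀ i ∈ T, ∀ x, deriv S f (flip {i} x) = deriv S f x := fun i hi x => by
      have hiS := Finset.disjoint_right.1 hST hi
      have := hf (insert i S) x (by rw [Finset.card_insert_of_notMem hiS]; omega)
      rw [deriv_insert hiS] at this
      exact (CharTwo.add_eq_zero.1 this).symm
    have hpw : ∀ a, deriv S (fun x => f (T.piecewise a x)) z = deriv S f (T.piecewise a z) :=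
      fun a => Finset.sum_congr rfl fun U hU => by
        rw [flip_piecewise (Finset.disjoint_of_subset_left (Finset.mem_powerset.1 hU) hST)]
    rw [hpw, piecewise_eq_of_flip_eq hinv, ← piecewise_eq_of_flip_eq hinv c, ← hpw]
    exact deriv_eq_zero_of_const hS0 fun U _ => hc _
  · -- In a direction from `T` the restricted function does not change.
    obtain ⟨i, hiS, hiT⟩ := Finset.not_disjoint_iff.1 hST
    rw [← Finset.insert_erase hiS, deriv_insert (Finset.notMem_erase i S)]
    have : ∀ U, T.piecewise b (flip U (flip {i} z)) = T.piecewise b (flip U z) := fun U => by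
      funext j
      by_cases hj : j ∈ T
      · simp [hj]
      · have : j ≠ i := fun h => hj (h ▸ hiT)
        simp [flip, hj, this]
    simp only [deriv, this]
    exact zmod_two_add_self _

/-! ### Alternation -/

/-- From `z` upwards, `f` can change its value `k` times along an increasing sequence. Consecutive
points of the sequence need not be neighbours in the cube. -/
def HasAlt (f : Cube n → Bool) : ℕ → Cube n → Prop
  | 0, _ => True
  | k + 1, z => ∃ y, z ≤ y ∧ f y ≠ f z ∧ HasAlt f k y

lemma HasAlt.mono_left {f : Cube n → Bool} {k : ℕ} {y z : Cube n} (h : HasAlt f k y)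
    (hzy : z ≤ y) : HasAlt f k z := by
  induction k generalizing y z with
  | zero => trivial
  | succ k ih =>
    obtain ⟨w, hyw, hne, hw⟩ := h
    by_cases hz : f w = f z
    · exact ⟨y, hzy, fun h => hne (hz.trans h.symm), ih hw hyw⟩
    · exact ⟨w, hzy.trans hyw, hz, hw⟩

lemma HasAlt.of_comp {f : Cube n → Bool} {φ : Cube n → Cube n} (hφ : Monotone φ) {k : ℕ}
    {z : Cube n} (h : HasAlt (fun x => f (φ x)) k z) : HasAlt f k (φ z) := by
  induction k generalizing z with
  | zero => trivial
  | succ k ih =>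
    obtain ⟨y, hzy, hne, hy⟩ := h
    exact ⟨φ y, hφ hzy, hne, ih hy⟩

/-- An alternating sequence is refined to a chain through neighbouring points, ending at the top. -/
lemma HasAlt.exists_chain {f : Cube n → Bool} {m k : ℕ} {z : Cube n}
    (hm : (Finset.univ.filter fun i => z i = false).card = m) (h : HasAlt f k z) :
    ∃ x : Fin (m + 1) → Cube n, StrictMono x ∧ x 0 = z ∧
      k ≤ ∑ i : Fin m, if f (x i.castSucc) ≠ f (x i.succ) then 1 else 0 := by
  induction m generalizing z k with
  | zero =>
    refine ⟨fun _ => z, fun i j hij => absurd hij (by omega), rfl, ?_⟩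
    rcases k with _ | k
    · simp
    · obtain ⟨y, hzy, hne, -⟩ := h
      refine absurd (congrArg f (le_antisymm ?_ hzy)) hne
      intro i
      have : z i = true := by
        simpa using Finset.filter_eq_empty_iff.1 (Finset.card_eq_zero.1 hm) (Finset.mem_univ i)
      rw [this]
      exact Bool.le_true _
  | succ m ih =>
    have step : ∀ i, z i = false → z < flip {i} z ∧
        (Finset.univ.filter fun j => flip {i} z j = false).card = m := by
      intro i hi
      constructor
      · rw [Pi.lt_def]
        refine ⟨fun j => ?_, i, by simp [flip, hi]⟩
        by_cases hj : j = i
        · subst hj; simp [hi]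
        · simp [flip, hj]
      · have : (Finset.univ.filter fun j => flip {i} z j = false)
            = (Finset.univ.filter fun j => z j = false).erase i := by
          ext j
          by_cases hj : j = i
          · subst hj; simp [flip, hi]
          · simp [flip, hj]
        rw [this, Finset.card_erase_of_mem (by simpa using hi), hm]
        rfl
    have glue : ∀ i, z i = false → ∀ k', HasAlt f k' (flip {i} z) →
        k ≤ k' + (if f z ≠ f (flip {i} z) then 1 else 0) →
        ∃ x : Fin (m + 1 + 1) → Cube n, StrictMono x ∧ x 0 = z ∧
          k ≤ ∑ i : Fin (m + 1), if f (x i.castSucc) ≠ f (x i.succ) then 1 else 0 := by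
      intro i hi k' hk' hk
      obtain ⟨x, hx, hx0, hxk⟩ := ih (step i hi).2 hk'
      refine ⟨Fin.cons z x, ?_, rfl, ?_⟩
      · rw [Fin.strictMono_iff_lt_succ]
        intro j
        refine Fin.cases ?_ (fun j => ?_) j
        · simpa [hx0] using (step i hi).1
        · simpa [← Fin.succ_castSucc] using hx Fin.castSucc_lt_succ
      · rw [Fin.sum_univ_succ]
        simp only [Fin.castSucc_zero, Fin.cons_zero, Fin.cons_succ, ← Fin.succ_castSucc, hx0]
        omega
    rcases k with _ | k
    · obtain ⟨i, hi⟩ := Finset.card_pos.1 (by rw [hm]; omega :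
        0 < (Finset.univ.filter fun i => z i = false).card)
      exact glue i (by simpa using hi) 0 trivial (Nat.zero_le _)
    · obtain ⟨y, hzy, hne, hy⟩ := h
      obtain ⟨i, hi⟩ := Function.ne_iff.1 (fun h : y = z => hne (congrArg f h))
      have hzi : z i = false := by
        have := hzy i
        revert this hi
        cases z i <;> cases y i <;> simp
      have hyi : y i = true := by simpa [hzi] using hi
      have hle : flip {i} z ≤ y := fun j => by
        by_cases hj : j = i
        · subst hj; simp [hyi]
        · simpa [flip, hj] using hzy j
      by_cases hf : f (flip {i} z) = f z
      · exact glue i hzi (k + 1) ⟨y, hle, hf ▸ hne, hy⟩ (by omega)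
      · exact glue i hzi k (hy.mono_left hle) (by simp [Ne.symm hf])

lemma not_hasAlt (f : Cube n → Bool) : ¬ HasAlt f (alt f + 1) ⊥ := by
  classical
  intro h
  obtain ⟨x, hx, -, hk⟩ := h.exists_chain (m := n) (by simp)
  rw [← Finset.card_filter] at hk
  have : altOn f x ≤ alt f := Finset.le_sup (f := altOn f)
    (Finset.mem_filter.2 ⟨Finset.mem_univ x, hx⟩)
  rw [altOn] at this
  omega

/-- Few alternations and low degree give a small certificate. Climbing from `z` to a minimal point
with another value crosses a subcube on which `f` is a monomial up to a constant, hence at most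
`d` coordinates; at most `k` such climbs lead to a point above which `f` is constant. -/
lemma exists_const_above {f : Cube n → Bool} {d : ℕ} (hd : DegreeLE d f) {k : ℕ} {z : Cube n}
    (h : ¬ HasAlt f (k + 1) z) : ∃ y, z ≤ y ∧ (∀ x, y ≤ x → f x = f y) ∧
      (Finset.univ.filter fun i => y i = true).card
        ≤ (Finset.univ.filter fun i => z i = true).card + k * d := by
  induction k generalizing z with
  | zero =>
    refine ⟨z, le_rfl, fun x hx => ?_, by simp⟩
    by_contra hne
    exact h ⟨x, hx, hne, trivial⟩
  | succ k ih =>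
    by_cases hz : ∀ x, z ≤ x → f x = f z
    · exact ⟨z, le_rfl, hz, Nat.le_add_right _ _⟩
    · push Not at hz
      obtain ⟨y, ⟨hzy, hne⟩, hmin⟩ := wellFounded_lt.has_min {x | z ≤ x ∧ f x ≠ f z} hz
      have hmin' : ∀ x, z ≤ x → x < y → f x = f z := fun x hzx hxy => by
        by_contra hx
        exact hmin x ⟨hzx, hx⟩ hxy
      obtain ⟨w, hyw, hw, hcard⟩ := ih (z := y) fun h' => h ⟨y, hzy, hne, h'⟩
      refine ⟨w, hzy.trans hyw, hw, hcard.trans ?_⟩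
      set S : Finset (Fin n) := Finset.univ.filter fun i => y i = true ∧ z i = false with hS
      have hflip : flip S z = y := by
        funext i
        have := hzy i
        revert this
        cases hzi : z i <;> cases hyi : y i <;> simp [flip, hS, hzi, hyi]
      have hSne : S.Nonempty := by
        rw [Finset.nonempty_iff_ne_empty]
        intro h0
        rw [h0, flip_empty] at hflip
        exact hne (congrArg f hflip.symm)
      have hlow : ∀ U ⊂ S, f (flip U z) = f z := by
        intro U hU
        obtain ⟨i, hiS, hiU⟩ := Finset.exists_of_ssubset hU
        have hsub := hU.subset
        refine hmin' _ (fun j => ?_) (Pi.lt_def.2 ⟨fun j => ?_, i, ?_⟩)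
        · by_cases hj : j ∈ U
          · have : z j = false := by simpa [hS] using (Finset.mem_filter.1 (hsub hj)).2.2
            simp [this]
          · simp [flip, hj]
        · by_cases hj : j ∈ U
          · have : y j = true := (Finset.mem_filter.1 (hsub hj)).2.1
            rw [this]; exact Bool.le_true _
          · simpa [flip, hj] using hzy j
        · have := (Finset.mem_filter.1 hiS).2
          simp [flip, hiU, this.1, this.2]
      have hle : S.card ≤ d := by
        by_contra! hlt
        have h1 := deriv_eq_one hSne hlow (hflip ▸ hne)
        rw [hd S z hlt] at h1
        exact zero_ne_one h1
      have hunion : (Finset.univ.filter fun i => y i = true)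
          ⊆ (Finset.univ.filter fun i => z i = true) ∪ S := by
        intro i hi
        cases hzi : z i <;> simp_all
      have := (Finset.card_le_card hunion).trans (Finset.card_union_le _ _)
      rw [add_mul]
      omega

/-! ### Decision trees -/

/-- `f` is computed by a decision tree of depth at most `d`. -/
inductive DecisionTree : ℕ → (Cube n → Bool) → Prop
  | const (d : ℕ) (b : Bool) : DecisionTree d fun _ => b
  | query {d : ℕ} (i : Fin n) {f₀ f₁ : Cube n → Bool} (h₀ : DecisionTree d f₀)
      (h₁ : DecisionTree d f₁) : DecisionTree (d + 1) fun x => if x i then f₁ x else f₀ x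

lemma DecisionTree.mono {d e : ℕ} {f : Cube n → Bool} (h : DecisionTree d f) (hde : d ≤ e) :
    DecisionTree e f := by
  induction h generalizing e with
  | const d b => exact .const e b
  | query i _ _ ih₀ ih₁ =>
    obtain ⟨e, rfl⟩ : ∃ e', e = e' + 1 := ⟨e - 1, by omega⟩
    exact .query i (ih₀ (by omega)) (ih₁ (by omega))

/-- Querying all bits in `T` and continuing with a tree for the restricted function. -/
lemma DecisionTree.of_restrict {d : ℕ} {f : Cube n → Bool} (T : Finset (Fin n))
    (h : ∀ b, DecisionTree d fun x => f (T.piecewise b x)) : DecisionTree (d + T.card) f := by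
  classical
  induction T using Finset.induction_on generalizing f with
  | empty => simpa using h (fun _ => false)
  | insert i T hi ih =>
    have hv : ∀ v, DecisionTree (d + T.card) fun x => f (Function.update x i v) := fun v => by
      refine ih fun b => ?_
      have := h (Function.update b i v)
      convert this using 3 with x
      funext j
      by_cases hj : j = i
      · subst hj; simp
      · by_cases hjT : j ∈ T <;> simp [hj, hjT]
    rw [Finset.card_insert_of_notMem hi, ← add_assoc]
    convert DecisionTree.query i (hv false) (hv true) using 1
    funext x
    cases hx : x i <;> simp [← hx]

/-- Each round queries a certificate and thereby lowers the degree. -/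
lemma DegreeLE.decisionTree {d k : ℕ} {f : Cube n → Bool} (hd : DegreeLE d f)
    (hk : ¬ HasAlt f (k + 1) ⊥) : DecisionTree (k * d ^ 2) f := by
  induction d generalizing f with
  | zero =>
    have : f = fun _ => f ⊥ := funext fun x => eq_of_degreeLE_zero hd x ⊥
    rw [this]
    exact .const _ _
  | succ d ih =>
    obtain ⟨y, -, hy, hcard⟩ := exists_const_above hd hk
    set T : Finset (Fin n) := Finset.univ.filter fun i => y i = true with hT
    have hc : ∀ x, f (T.piecewise y x) = f y := fun x => hy _ fun j => by
      by_cases hj : j ∈ T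
      · simp [hj]
      · have : y j = false := by simpa [hT] using hj
        simp [this]
    refine (DecisionTree.of_restrict T fun b => ih (hd.restrict hc b) fun h => hk ?_).mono
      (?_ : k * d ^ 2 + T.card ≤ _)
    · refine (h.of_comp fun x x' hx j => ?_).mono_left bot_le
      by_cases hj : j ∈ T
      · simp [hj]
      · simpa [hj] using hx j
    · have : T.card ≤ k * (d + 1) := by simpa using hcard
      nlinarith

/-- Both players announce their part of each queried bit. -/
lemma DecisionTree.exists_protocol {d : ℕ} {f : Cube n → Bool} (h : DecisionTree d f) :
    ∃ P : Protocol (Cube n) (Cube n), P.Computes (xorFun f) ∧ ∀ x y, P.bits x y ≤ 2 * d := by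
  induction h with
  | const d b => exact ⟨.leaf b, fun _ _ => rfl, fun _ _ => Nat.zero_le _⟩
  | query i _ _ ih₀ ih₁ =>
    obtain ⟨P₀, h₀, c₀⟩ := ih₀
    obtain ⟨P₁, h₁, c₁⟩ := ih₁
    refine ⟨.alice (fun x => x i) (.bob (fun y => y i) P₀ P₁) (.bob (fun y => y i) P₁ P₀),
      fun x y => ?_, fun x y => ?_⟩
    · have e₀ := h₀ x y
      have e₁ := h₁ x y
      simp only [xorFun] at e₀ e₁
      cases hx : x i <;> cases hy : y i <;> simp [Protocol.eval, xorFun, hx, hy, e₀, e₁]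
    · have e₀ := c₀ x y
      have e₁ := c₁ x y
      cases hx : x i <;> cases hy : y i <;> simp [Protocol.bits, hx, hy] <;> omega

lemma DecisionTree.CCxor_le {d : ℕ} {f : Cube n → Bool} (h : DecisionTree d f) :
    CCxor f ≤ 2 * d := by
  obtain ⟨P, hP, hb⟩ := h.exists_protocol
  have hle : CCxor f ≤ P.cost := Nat.sInf_le ⟨P, hP, rfl⟩
  exact hle.trans (Finset.sup_le fun z _ => hb z.1 z.2)

lemma sgn_mul_chi (i : Fin n) (S : Finset (Fin n)) (x : Cube n) :
    sgn (x i) * chi S x = chi (symmDiff S {i}) x := by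
  have hs : sgn (x i) * sgn (x i) = 1 := by cases x i <;> norm_num [sgn]
  by_cases hi : i ∈ S
  · have : symmDiff S {i} = S.erase i := by
      ext j; by_cases hj : j = i
      · subst hj; simp [Finset.mem_symmDiff, hi]
      · simp [Finset.mem_symmDiff, hj]
    rw [this, chi_eq_prod, chi_eq_prod, ← Finset.mul_prod_erase S _ hi, ← mul_assoc, hs, one_mul]
  · have : symmDiff S {i} = insert i S := by
      ext j; by_cases hj : j = i
      · subst hj; simp [Finset.mem_symmDiff, hi]
      · simp [Finset.mem_symmDiff, hj]
    rw [this, chi_eq_prod, chi_eq_prod, Finset.prod_insert hi]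

lemma card_lt_card_symmDiff {d : ℕ} {S : Finset (Fin n)} (i : Fin n) (h : d + 1 < S.card) :
    d < (symmDiff S {i}).card := by
  have : S.erase i ⊆ symmDiff S {i} := fun j hj => by
    rw [Finset.mem_erase] at hj
    simp [Finset.mem_symmDiff, hj.1, hj.2]
  have := Finset.card_le_card this
  have := Finset.pred_card_le_card_erase (s := S) (a := i)
  omega

/-- The Fourier support of a tree of depth `d` consists of sets with at most `d` elements. -/
lemma DecisionTree.sum_sgn_mul_chi_eq_zero {d : ℕ} {f : Cube n → Bool} (h : DecisionTree d f)
    {S : Finset (Fin n)} (hS : d < S.card) : ∑ x, sgn (f x) * chi S x = 0 := by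
  induction h generalizing S with
  | const d b =>
    rw [← Finset.mul_sum]
    obtain ⟨i, hi⟩ := Finset.card_pos.1 (Nat.zero_lt_of_lt hS)
    have hflip : ∀ x : Cube n, chi S (flip {i} x) = - chi S x := fun x => by
      rw [chi_flip]; simp [hi]
    have hinv : Function.Involutive (flip ({i} : Finset (Fin n))) := fun x => by
      funext j
      by_cases hj : j = i <;> simp [flip, hj]
    have hsum := Equiv.sum_comp hinv.toPerm (chi S)
    simp only [Function.Involutive.coe_toPerm, hflip, Finset.sum_neg_distrib] at hsum
    rw [show ∑ x, chi S x = 0 by linarith, mul_zero]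
  | query i _ _ ih₀ ih₁ =>
    rename_i d f₀ f₁ _ _
    -- The indicators of the two branches are `(1 ± sgn (x i)) / 2`.
    have key : ∀ x : Cube n, sgn (if x i then f₁ x else f₀ x) * chi S x
        = (1 / 2) * (sgn (f₀ x) * chi S x) + (1 / 2) * (sgn (f₀ x) * chi (symmDiff S {i}) x)
          + ((1 / 2) * (sgn (f₁ x) * chi S x)
            - (1 / 2) * (sgn (f₁ x) * chi (symmDiff S {i}) x)) := fun x => by
      rw [← sgn_mul_chi]
      cases x i <;> simp only [sgn, if_true, Bool.false_eq_true, if_false] <;> ring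
    have hS' := card_lt_card_symmDiff i hS
    simp_rw [key, Finset.sum_add_distrib, Finset.sum_sub_distrib, ← Finset.mul_sum,
      ih₀ (Nat.lt_of_succ_lt hS), ih₁ (Nat.lt_of_succ_lt hS), ih₀ hS', ih₁ hS']
    simp

/-- The sets of the Fourier support cover all relevant coordinates, and each has at most as many
elements as the tree is deep. -/
lemma DecisionTree.le_sparsity_mul {d : ℕ} {f : Cube n → Bool} (h : DecisionTree d f)
    (hf : DependsOnAllInputs f) : n ≤ sparsity f * d := by
  classical
  have hcover : (Finset.univ : Finset (Fin n)) ⊆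
      (Finset.univ.filter fun S : Finset (Fin n) => cubeFourierCoeff f S ≠ 0).biUnion id := by
    intro i _
    obtain ⟨x, hx⟩ := hf i
    rw [← flip_singleton] at hx
    obtain ⟨S, hiS, hS⟩ := exists_mem_of_flip_ne hx
    exact Finset.mem_biUnion.2 ⟨S, by simpa using hS, hiS⟩
  have hcard := (Finset.card_le_card hcover).trans
    (Finset.card_biUnion_le_card_mul _ _ d fun S hS => ?_)
  · rw [Finset.card_univ, Fintype.card_fin] at hcard
    rw [sparsity]
    convert hcard
  · by_contra! hlt
    refine (Finset.mem_filter.1 hS).2 ?_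
    simp only [cubeFourierCoeff, one_sub_two_toNat]
    exact (congrArg _ (h.sum_sgn_mul_chi_eq_zero hlt)).trans (mul_zero _)

/-! ### Bounds in terms of alternation and sparsity -/

lemma sq_le_two_mul_two_pow (d : ℕ) : d ^ 2 ≤ 2 * 2 ^ d := by
  rcases le_or_gt d 2 with h | h
  · interval_cases d <;> norm_num
  · induction d, h using Nat.le_induction with
    | base => norm_num
    | succ d hd ih => rw [pow_succ 2 d]; nlinarith

lemma max_log_sq_le {s : ℕ} (hs : 1 ≤ s) : (max 1 (Nat.log 2 s)) ^ 2 ≤ 2 * s := by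
  rcases max_cases 1 (Nat.log 2 s) with ⟨h, _⟩ | ⟨h, _⟩ <;> rw [h]
  · omega
  · exact (sq_le_two_mul_two_pow _).trans
      (Nat.mul_le_mul_left 2 (Nat.pow_log_le_self 2 (by omega)))

lemma decisionTree_alt_mul (f : Cube n → Bool) :
    DecisionTree (alt f * max 1 (Nat.log 2 (sparsity f)) ^ 2) f :=
  (degreeLE_max_log_sparsity f).decisionTree (not_hasAlt f)

lemma eventually_polylog_le_sqrt (B : ℝ) (a : ℕ) :
    ∀ᶠ m : ℕ in Filter.atTop, B * (Real.logb 2 m) ^ a ≤ √m := by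
  have h := (isLittleO_log_rpow_rpow_atTop (a : ℝ) (by norm_num : (0 : ℝ) < 1 / 2)).const_mul_left
    (B / Real.log 2 ^ a)
  have h' := (h.comp_tendsto tendsto_natCast_atTop_atTop).bound one_pos
  filter_upwards [h'] with m hm
  simp only [Function.comp, Real.rpow_natCast, one_mul, ← Real.sqrt_eq_rpow, Real.norm_eq_abs,
    abs_of_nonneg (Real.sqrt_nonneg _)] at hm
  refine le_trans (le_of_eq ?_) ((le_abs_self _).trans hm)
  rw [Real.logb, div_pow]
  ring

end XorLogRank

theorem theorem3 :
    ∀ (A : ℝ) (a : ℕ), ∃ (C : ℝ) (k N : ℕ), ∀ n : ℕ, N ≤ n →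
      ∀ f : XorLogRank.Cube n → Bool,
        XorLogRank.DependsOnAllInputs f →
        (XorLogRank.alt f : ℝ) ≤ A * (Real.logb 2 (n : ℝ)) ^ a →
        (XorLogRank.CCxor f : ℝ) ≤ C * (Real.logb 2 (XorLogRank.sparsity f : ℝ)) ^ k := by
  open XorLogRank in
  intro A a
  obtain ⟨N, hN⟩ := Filter.eventually_atTop.1 (eventually_polylog_le_sqrt (2 * A) a)
  refine ⟨2 * |A| * 4 ^ a, a + 2, max N 16, fun n hn f hf halt => ?_⟩
  have hn16 : (16 : ℝ) ≤ n := by exact_mod_cast (le_max_right N 16).trans hn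
  have htree := decisionTree_alt_mul f
  have hcover := htree.le_sparsity_mul hf
  have hcost := htree.CCxor_le
  set s := sparsity f
  set d := max 1 (Nat.log 2 s)
  have hs : 1 ≤ s := by
    by_contra! h0
    have : s = 0 := by omega
    rw [this, zero_mul] at hcover
    have : 16 ≤ n := (le_max_right N 16).trans hn
    omega
  have hd : (d : ℝ) ^ 2 ≤ 2 * s := by exact_mod_cast max_log_sq_le hs
  -- The sparsity is polynomially large in `n`, as `n ≤ s · alt f · d ^ 2 ≤ 2 · alt f · s ^ 2` and
  -- `alt f` is polylogarithmic.
  have hsqrt : √(n : ℝ) ≤ (s : ℝ) ^ 2 := by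
    have h1 : (n : ℝ) ≤ s * (alt f * d ^ 2) := by exact_mod_cast hcover
    have h2 : (n : ℝ) ≤ √n * s ^ 2 := calc
      (n : ℝ) ≤ s * (alt f * (2 * s)) := h1.trans (by gcongr)
      _ = 2 * (alt f : ℝ) * s ^ 2 := by ring
      _ ≤ √n * s ^ 2 := by
        gcongr
        linarith [hN n ((le_max_left N 16).trans hn)]
    have hpos : 0 < √(n : ℝ) := Real.sqrt_pos.2 (by linarith)
    have h3 := Real.mul_self_sqrt (by linarith : (0 : ℝ) ≤ n)
    exact le_of_mul_le_mul_left (by linarith) hpos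
  have hlog : Real.logb 2 n ≤ 4 * Real.logb 2 s := by
    have h4 : (n : ℝ) ≤ (s : ℝ) ^ 4 := calc
      (n : ℝ) = √n ^ 2 := (Real.sq_sqrt (by linarith)).symm
      _ ≤ ((s : ℝ) ^ 2) ^ 2 := by gcongr
      _ = (s : ℝ) ^ 4 := by ring
    have := Real.logb_le_logb_of_le one_lt_two (by linarith) h4
    rwa [Real.logb_pow] at this
  have hlogn : 4 ≤ Real.logb 2 n := by
    rw [Real.le_logb_iff_rpow_le one_lt_two (by linarith)]
    norm_num
    exact_mod_cast hn16
  have hdlog : (d : ℝ) ≤ Real.logb 2 s := by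
    rw [Nat.cast_max, Nat.cast_one]
    exact max_le (by linarith) (Real.natLog_le_logb s 2)
  have hcost' : (CCxor f : ℝ) ≤ 2 * (alt f * d ^ 2) := by exact_mod_cast hcost
  have halt' : (alt f : ℝ) ≤ |A| * (4 * Real.logb 2 s) ^ a :=
    halt.trans (mul_le_mul (le_abs_self A) (pow_le_pow_left₀ (by linarith) hlog a)
      (pow_nonneg (by linarith) a) (abs_nonneg A))
  calc (CCxor f : ℝ) ≤ 2 * (alt f * d ^ 2) := hcost'
    _ ≤ 2 * ((|A| * (4 * Real.logb 2 s) ^ a) * Real.logb 2 s ^ 2) := by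
      gcongr
      exact (Nat.cast_nonneg _).trans halt'
    _ = 2 * |A| * 4 ^ a * Real.logb 2 s ^ (a + 2) := by ring
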